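/- Let $\lambda=(\lambda_1>\lambda_2>\dots>\lambda_l>0)$ be a strict partition (all nonzero parts distinct) of length $l=\ell(\lambda)\ge 0$, let $n\ge l$, and let $a=(a_k)_{k\ge1}$ be a sequence of complex numbers with $a_1=0$. Put $(x\mid a)^k=\prod_{j=1}^k(x-a_j)$, with $(x\mid a)^0=1$. The multiparameter Schur $P$-function of $\lambda$ in $n$ variables is $$ P_{\lambda;a}(x_1,\dots,x_n)=\frac1{(n-l)!}\sum_{\omega\in S(n)}\ \prod_{i=1}^l (x_{\omega(i)}\mid a)^{\lambda_i}\prod_{\substack{1\le i\le l\\ i<j\le n}}\frac{x_{\omega(i)}+x_{\omega(j)}}{x_{\omega(i)}-x_{\omega(j)}} . $$ The Pfaffian of a skew-symmetric $2N\times 2N$ matrix $A=(A_{ij})$ is $$ \operatorname{Pf}(A)=\sum_{\omega}\operatorname{sgn}(\omega)\prod_{i=1}^N A_{\omega(2i-1)\,\omega(2i)}, $$ where the sum is over the $\omega\in S(2N)$ with $\omega(2i-1)<\omega(2i)$ for all $i$ and $\omega(1)<\omega(3)<\dots<\omega(2N-1)$ (so $\operatorname{Pf}=1$ for $N=0$).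 Let $A_0(x_1,\dots,x_n)$ be the skew-symmetric $n\times n$ matrix $\left(\frac{x_i-x_j}{x_i+x_j}\right)_{1\le i,j\le n}$ (its diagonal entries are $0$, also when a variable is $0$), let $B_\lambda(x_1,\dots,x_n)$ be the $n\times l$ matrix with $(i,j)$ entry $(x_i\mid a)^{\lambda_{l+1-j}}$, and let $A_\lambda(x_1,\dots,x_n)$ be the skew-symmetric $(n+l)\times(n+l)$ matrix $$ \begin{pmatrix}A_0(x_1,\dots,x_n)&B_\lambda(x_1,\dots,x_n)\\-B_\lambda(x_1,\dots,x_n)^t&0\end{pmatrix}. $$ Put $$ \operatorname{Pf}_0(x_1,\dots,x_n)=\begin{cases}\operatorname{Pf}(A_0(x_1,\dots,x_n))&\text{if } n \text{ is even},\\ \operatorname{Pf}(A_0(x_1,\dots,x_n,0))&\text{if } n \text{ is odd},\end{cases} $$ $$ \operatorname{Pf}_\lambda(x_1,\dots,x_n)=\begin{cases}\operatorname{Pf}(A_\lambda(x_1,\dots,x_n))&\text{if } n+l \text{ is even},\\ \operatorname{Pf}(A_\lambda(x_1,\dots,x_n,0))&\text{if } n+l \text{ is odd}.\end{cases} $$ Then,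 in the field $\mathbb C(x_1,\dots,x_n)$ of rational functions, $\operatorname{Pf}_0(x_1,\dots,x_n)\neq0$ and $$ P_{\lambda;a}(x_1,\dots,x_n)=\frac{\operatorname{Pf}_\lambda(x_1,\dots,x_n)}{\operatorname{Pf}_0(x_1,\dots,x_n)} . $$ -/

import Mathlib

open Finset

noncomputable section

/-- The generalized power `(x | a)^k = (x - a_1)(x - a_2)⋯(x - a_k)`, for a sequence
`a = (a_k)_{k ≥ 1}`.  The value `a 0` is never used. -/
def genPow {K : Type*} [CommRing K] (x : K) (a : ℕ → K) (k : ℕ) : K :=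
  ∏ j ∈ Finset.Icc 1 k, (x - a j)

/-- The length `ℓ(λ)`: the number of (nonzero) parts. -/
def partLength {m : ℕ} (lam : m.Partition) : ℕ := Multiset.card lam.parts

/-- The parts of `λ` in weakly decreasing order, counted from `0`: `partAt lam i = λ_{i+1}`
(and `0` when `i ≥ ℓ(λ)`). -/
def partAt {m : ℕ} (lam : m.Partition) (i : ℕ) : ℕ :=
  (lam.parts.sort (fun p q => q ≤ p)).getD i 0

/-- The Pfaffian of an `N × N` skew-symmetric matrix, `N` even: the sum of
`sgn(ω) ∏ A_{ω(2i-1) ω(2i)}` over the permutations `ω` with `ω(2i-1) < ω(2i)` for all `i` and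
`ω(1) < ω(3) < ⋯`.  (Indices are counted from `0` in the code.)  It is `0` for odd `N`. -/
def pfaffian {K : Type*} [CommRing K] {N : ℕ} (A : Matrix (Fin N) (Fin N) K) : K :=
  if Even N then
    ∑ ω : Equiv.Perm (Fin N) with
        (∀ i : Fin (N / 2), ω ⟨2 * i, by omega⟩ < ω ⟨2 * i + 1, by omega⟩) ∧
        (∀ i j : Fin (N / 2), i < j → ω ⟨2 * i, by omega⟩ < ω ⟨2 * j, by omega⟩),
      ((Equiv.Perm.sign ω : ℤ) : K) *
        ∏ i : Fin (N / 2), A (ω ⟨2 * i, by omega⟩) (ω ⟨2 * i + 1, by omega⟩)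
  else 0

variable {K : Type*} [Field K]

/-- The multiparameter Schur P-function of `λ` in the `n` variables `x_1, …, x_n`. -/
def schurP {m : ℕ} (lam : m.Partition) (a : ℕ → K) {n : ℕ} (x : Fin n → K) : K :=
  if partLength lam ≤ n then
    (((n - partLength lam).factorial : ℕ) : K)⁻¹ *
      ∑ ω : Equiv.Perm (Fin n),
        (∏ i : Fin n with i.val < partLength lam, genPow (x (ω i)) a (partAt lam i)) *
        ∏ i : Fin n with i.val < partLength lam, ∏ j : Fin n with i < j,
          (x (ω i) + x (ω j)) / (x (ω i) - x (ω j))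
  else 0

/-- The skew-symmetric matrix `((x_i - x_j) / (x_i + x_j))`.  Its diagonal is `0`, also at a
variable equal to `0`, by the convention `0 / 0 = 0`. -/
def matA0 {n : ℕ} (x : Fin n → K) : Matrix (Fin n) (Fin n) K :=
  Matrix.of fun i j => (x i - x j) / (x i + x j)

/-- The `n × l` matrix `((x_i | a)^{λ_{l+1-j}})`, where `l = ℓ(λ)`. -/
def matB {m : ℕ} (lam : m.Partition) (a : ℕ → K) {n : ℕ} (x : Fin n → K) :
    Matrix (Fin n) (Fin (partLength lam)) K :=
  Matrix.of fun i j => genPow (x i) a (partAt lam j.rev)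

/-- The skew-symmetric `(n + l) × (n + l)` block matrix `[[A_0, B_λ], [-B_λᵗ, 0]]`. -/
def matA {m : ℕ} (lam : m.Partition) (a : ℕ → K) {n : ℕ} (x : Fin n → K) :
    Matrix (Fin (n + partLength lam)) (Fin (n + partLength lam)) K :=
  Matrix.reindex finSumFinEquiv finSumFinEquiv
    (Matrix.fromBlocks (matA0 x) (matB lam a x) (-(matB lam a x).transpose) 0)

/-- `Pf_0(x_1, …, x_n)`: a zero variable is appended when `n` is odd. -/
def pfZero {n : ℕ} (x : Fin n → K) : K :=
  if Even n then pfaffian (matA0 x)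
  else pfaffian (matA0 (Fin.snoc (α := fun _ => K) x 0))

/-- `Pf_λ(x_1, …, x_n)`: a zero variable is appended when `n + l` is odd. -/
def pfLambda {m : ℕ} (lam : m.Partition) (a : ℕ → K) {n : ℕ} (x : Fin n → K) : K :=
  if Even (n + partLength lam) then pfaffian (matA lam a x)
  else pfaffian (matA lam a (Fin.snoc (α := fun _ => K) x 0))

/-- The field `ℂ(x_1, …, x_n)` of rational functions. -/
abbrev RatFun (n : ℕ) : Type := FractionRing (MvPolynomial (Fin n) ℂ)

/-- The variables `x_1, …, x_n` as elements of `ℂ(x_1, …, x_n)`. -/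
def ratVar (n : ℕ) (i : Fin n) : RatFun n :=
  algebraMap (MvPolynomial (Fin n) ℂ) (RatFun n) (MvPolynomial.X i)

/-- A complex number as a constant rational function. -/
def ratConst (n : ℕ) (c : ℂ) : RatFun n :=
  algebraMap (MvPolynomial (Fin n) ℂ) (RatFun n) (MvPolynomial.C c)

end

/-! Write D(x) for `diffProd x`. Deleting the variable x_p from D multiplies it, up to the sign
(-1)^p, by the cross product ∏_{j≠p} (x_p + x_j)/(x_p - x_j), which is also the factor that p = ω(1)
contributes to the P-function. Hence both sides obey one recursion, `crossSum`. Splitting the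
permutation sum by ω(1) gives P = `crossSum` (`sum_perm_eq_crossSum`). Expanding Pf(A_λ) along its
last column, which holds the powers λ_1, gives `crossSum` times D (`pfRec_block`).

The recursion ends at l = 0 with Schur's Pfaffian Pf(A_0) = D (`pfRec_diff_div_add`). This follows
by expansion along the first row from an identity of rational functions, obtained by Lagrange
interpolation (`sum_crossProd_eq_zero`).

For the odd cases, a_1 = 0 makes (0 | a)^k vanish for k > 0, so an appended zero variable changes
neither `crossSum` nor D. -/

/-! ### Permutations split by the image of the first point -/

section Permutations

/-- The permutation of `Fin (n + 1)` sending `0` to `p` and acting on the remaining points as `σ`,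
up to the order isomorphism of `Fin n` with the complement of `p`. -/
def consPerm {n : ℕ} (p : Fin (n + 1)) (σ : Equiv.Perm (Fin n)) : Equiv.Perm (Fin (n + 1)) :=
  p.cycleRange.symm * Equiv.Perm.decomposeFin.symm (0, σ)

@[simp] lemma consPerm_zero {n : ℕ} (p : Fin (n + 1)) (σ : Equiv.Perm (Fin n)) :
    consPerm p σ 0 = p := by
  simp [consPerm]

@[simp] lemma consPerm_succ {n : ℕ} (p : Fin (n + 1)) (σ : Equiv.Perm (Fin n)) (j : Fin n) :
    consPerm p σ j.succ = p.succAbove (σ j) := by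
  simp [consPerm]

lemma sign_consPerm {n : ℕ} (p : Fin (n + 1)) (σ : Equiv.Perm (Fin n)) :
    Equiv.Perm.sign (consPerm p σ) = (-1) ^ (p : ℕ) * Equiv.Perm.sign σ := by
  simp [consPerm, Fin.sign_cycleRange]

lemma consPerm_bijective (n : ℕ) :
    Function.Bijective
      (fun q : Fin (n + 1) × Equiv.Perm (Fin n) => consPerm q.1 q.2) := by
  rw [Fintype.bijective_iff_injective_and_card]
  refine ⟨?_, by simp [Fintype.card_perm, Nat.factorial_succ]⟩
  rintro ⟨p, σ⟩ ⟨q, τ⟩ h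
  have h0 : p = q := by simpa using congrArg (fun e => e 0) h
  subst h0
  refine Prod.ext rfl (Equiv.ext fun j => ?_)
  have := congrArg (fun e => e j.succ) h
  simpa using this

lemma sum_perm_fin_succ {n : ℕ} {M : Type*} [AddCommMonoid M]
    (f : Equiv.Perm (Fin (n + 1)) → M) :
    ∑ ω, f ω = ∑ p, ∑ σ, f (consPerm p σ) := by
  rw [← Fintype.sum_prod_type']
  exact ((consPerm_bijective n).sum_comp f).symm

end Permutations

/-! ### Row and column expansions of the Pfaffian -/

section Pfaffian

variable {R : Type*} [CommRing R]

/-- The Pfaffian, defined by recursive expansion along the first row. -/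
def pfRec : (N : ℕ) → (Fin N → Fin N → R) → R
  | 0, _ => 1
  | 1, _ => 0
  | N + 2, A => ∑ p : Fin (N + 1), (-1) ^ (p : ℕ) * A 0 p.succ *
      pfRec N (fun i j => A (p.succAbove i).succ (p.succAbove j).succ)

lemma pfRec_add_two (N : ℕ) (A : Fin (N + 2) → Fin (N + 2) → R) :
    pfRec (N + 2) A = ∑ p : Fin (N + 1), (-1) ^ (p : ℕ) * A 0 p.succ *
      pfRec N (fun i j => A (p.succAbove i).succ (p.succAbove j).succ) := rfl

/-- The permutations over which the Pfaffian is summed: `ω(0) < ω(1)`, `ω(2) < ω(3)`, … and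
`ω(0) < ω(2) < ⋯`. -/
def IsMatchingPerm {k : ℕ} (ω : Equiv.Perm (Fin (2 * k))) : Prop :=
  (∀ i : Fin k, ω ⟨2 * i, by omega⟩ < ω ⟨2 * i + 1, by omega⟩) ∧
    ∀ i j : Fin k, i < j → ω ⟨2 * i, by omega⟩ < ω ⟨2 * j, by omega⟩

open Classical in
lemma pfaffian_eq_sum_isMatchingPerm {k : ℕ} (A : Matrix (Fin (2 * k)) (Fin (2 * k)) R) :
    pfaffian A = ∑ ω : Equiv.Perm (Fin (2 * k)),
      if IsMatchingPerm ω then ((Equiv.Perm.sign ω : ℤ) : R) *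
        ∏ i : Fin k, A (ω ⟨2 * i, by omega⟩) (ω ⟨2 * i + 1, by omega⟩) else 0 := by
  have hk : 2 * k / 2 = k := by omega
  rw [pfaffian, if_pos (even_two_mul k), ← Finset.sum_filter]
  refine Finset.sum_congr (Finset.filter_congr fun ω _ => ?_) fun ω _ => ?_
  · refine and_congr ⟨fun h i => ?_, fun h i => ?_⟩ ⟨fun h i j hij => ?_, fun h i j hij => ?_⟩
    · exact h (i.cast hk.symm)
    · exact h (i.cast hk)
    · exact h (i.cast hk.symm) (j.cast hk.symm) hij
    · exact h (i.cast hk) (j.cast hk) hij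
  · congr 1
    exact Fintype.prod_equiv (finCongr hk) _ _ fun i => rfl

/-- The matching `{0, p + 1}` together with a matching of the remaining points. -/
def consPair {N : ℕ} (p : Fin (N + 1)) (σ : Equiv.Perm (Fin N)) : Equiv.Perm (Fin (N + 2)) :=
  consPerm 0 (consPerm p σ)

lemma consPair_zero {N : ℕ} (p : Fin (N + 1)) (σ : Equiv.Perm (Fin N)) (h : 0 < N + 2) :
    consPair p σ ⟨0, h⟩ = 0 := consPerm_zero _ _

lemma consPair_one {N : ℕ} (p : Fin (N + 1)) (σ : Equiv.Perm (Fin N)) (h : 1 < N + 2) :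
    consPair p σ ⟨1, h⟩ = p.succ := by
  refine (consPerm_succ 0 (consPerm p σ) 0).trans ?_
  rw [consPerm_zero, Fin.zero_succAbove]

lemma consPair_add_two {N : ℕ} (p : Fin (N + 1)) (σ : Equiv.Perm (Fin N)) (j : ℕ)
    (h : j + 2 < N + 2) :
    consPair p σ ⟨j + 2, h⟩ = (p.succAbove (σ ⟨j, by omega⟩)).succ := by
  refine (consPerm_succ 0 (consPerm p σ) (Fin.succ ⟨j, by omega⟩)).trans ?_
  rw [consPerm_succ, Fin.zero_succAbove]

/-- The conditions on the first pair hold automatically, since its smaller element is 0, the least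
index; `succAbove` and `succ` preserve the order of the others. -/
lemma isMatchingPerm_consPair {k : ℕ} (p : Fin (2 * k + 1)) (σ : Equiv.Perm (Fin (2 * k))) :
    IsMatchingPerm (k := k + 1) (consPair p σ) ↔ IsMatchingPerm σ := by
  have h2 : ∀ i : Fin k, consPair p σ ⟨2 * (i + 1), by omega⟩ =
      (p.succAbove (σ ⟨2 * i, by omega⟩)).succ := fun i => consPair_add_two p σ (2 * i) (by omega)
  have h3 : ∀ i : Fin k, consPair p σ ⟨2 * (i + 1) + 1, by omega⟩ =
      (p.succAbove (σ ⟨2 * i + 1, by omega⟩)).succ :=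
    fun i => consPair_add_two p σ (2 * i + 1) (by omega)
  refine and_congr ?_ ?_
  · refine Fin.forall_fin_succ.trans ?_
    have h0 : consPair p σ ⟨2 * ((0 : Fin (k + 1)) : ℕ), by simp⟩ <
        consPair p σ ⟨2 * ((0 : Fin (k + 1)) : ℕ) + 1, by simp⟩ := by
      have a := consPair_zero p σ (by omega)
      have b := consPair_one p σ (by omega)
      simp only [Fin.val_zero, mul_zero, zero_add]
      rw [a, b]
      exact Fin.succ_pos p
    refine (and_iff_right h0).trans (forall_congr' fun i => ?_)
    simp only [Fin.val_succ]
    rw [h2, h3]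
    simp
  · constructor
    · intro h i j hij
      have := h i.succ j.succ (Fin.succ_lt_succ_iff.2 hij)
      simp only [Fin.val_succ] at this
      rw [h2, h2] at this
      simpa using this
    · intro h i j hij
      obtain ⟨j, rfl⟩ := Fin.exists_succ_eq.2 (Fin.ne_zero_of_lt hij)
      refine Fin.cases (fun _ => ?_) (fun i hij => ?_) i hij
      · simp only [Fin.val_zero, mul_zero, Fin.val_succ]
        rw [h2, consPair_zero p σ (by omega)]
        exact Fin.succ_pos _
      · simp only [Fin.val_succ]
        rw [h2, h2]
        simpa using h i j (Fin.succ_lt_succ_iff.1 hij)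

/-- The least index can be neither the second member of a pair nor the first member of a later pair.
-/
lemma not_isMatchingPerm_of_ne {k : ℕ} (ω : Equiv.Perm (Fin (2 * (k + 1))))
    (h0 : ω ⟨0, by omega⟩ ≠ ⟨0, by omega⟩) : ¬ IsMatchingPerm ω := by
  rintro ⟨h1, h2⟩
  obtain ⟨⟨j, hj⟩, hω⟩ := ω.surjective ⟨0, by omega⟩
  obtain ⟨i, rfl | rfl⟩ : ∃ i, j = 2 * i ∨ j = 2 * i + 1 := ⟨j / 2, by omega⟩
  · rcases Nat.eq_zero_or_pos i with rfl | hi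
    · exact h0 hω
    · have := h2 ⟨0, by omega⟩ ⟨i, by omega⟩ hi
      simp only [hω, Fin.lt_def] at this
      omega
  · have := h1 ⟨i, by omega⟩
    simp only [hω, Fin.lt_def] at this
    omega

lemma pfaffian_eq_pfRec (k : ℕ) (A : Matrix (Fin (2 * k)) (Fin (2 * k)) R) :
    pfaffian A = pfRec (2 * k) A := by
  classical
  induction k with
  | zero =>
    rw [pfaffian_eq_sum_isMatchingPerm]
    change _ = (1 : R)
    have : ∀ ω : Equiv.Perm (Fin (2 * 0)), IsMatchingPerm ω :=
      fun ω => ⟨fun i => i.elim0, fun i => i.elim0⟩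
    simp only [this, if_true]
    refine (Fintype.sum_unique (ι := Equiv.Perm (Fin 0)) _).trans ?_
    simp
  | succ k ih =>
    rw [pfaffian_eq_sum_isMatchingPerm]
    refine (sum_perm_fin_succ (n := 2 * k + 1) _).trans ?_
    rw [Fin.sum_univ_succ, Finset.sum_eq_zero (s := univ (α := Fin (2 * k + 1)))
      (fun q _ => Finset.sum_eq_zero fun τ _ => if_neg (not_isMatchingPerm_of_ne _ ?_)), add_zero,
      sum_perm_fin_succ]
    · refine Eq.trans ?_ (pfRec_add_two (2 * k) A).symm
      refine Finset.sum_congr rfl fun p _ => ?_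
      refine Eq.trans ?_ (congrArg _
        (ih (fun i j => A (p.succAbove i).succ (p.succAbove j).succ)))
      refine Eq.trans ?_ (congrArg _ (pfaffian_eq_sum_isMatchingPerm _).symm)
      refine Eq.trans ?_ (Finset.mul_sum _ _ _).symm
      refine Finset.sum_congr rfl fun σ _ => ?_
      have hiff := isMatchingPerm_consPair p σ
      change (if IsMatchingPerm (k := k + 1) (consPair p σ) then
        ((Equiv.Perm.sign (consPair p σ) : ℤ) : R) * ∏ i : Fin (k + 1),
          A (consPair p σ ⟨2 * i, by omega⟩) (consPair p σ ⟨2 * i + 1, by omega⟩) else 0) = _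
      rw [if_congr hiff rfl rfl, mul_ite, mul_zero]
      congr 1
      rw [Fin.prod_univ_succ]
      have e0 := consPair_zero p σ (by omega)
      have e1 := consPair_one p σ (by omega)
      have h2 : ∀ i : Fin k, consPair p σ ⟨2 * (i + 1), by omega⟩ =
          (p.succAbove (σ ⟨2 * i, by omega⟩)).succ :=
        fun i => consPair_add_two p σ (2 * i) (by omega)
      have h3 : ∀ i : Fin k, consPair p σ ⟨2 * (i + 1) + 1, by omega⟩ =
          (p.succAbove (σ ⟨2 * i + 1, by omega⟩)).succ :=
        fun i => consPair_add_two p σ (2 * i + 1) (by omega)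
      have hs : ((Equiv.Perm.sign (consPair p σ) : ℤ) : R) =
          (-1) ^ (p : ℕ) * ((Equiv.Perm.sign σ : ℤ) : R) := by
        simp [consPair, sign_consPerm]
      simp only [Fin.val_succ, Fin.val_zero, mul_zero, zero_add, h2, h3, e0, e1]
      rw [hs]
      ring
    · intro h
      have h' : consPerm q.succ τ 0 = 0 := h
      rw [consPerm_zero] at h'
      exact Fin.succ_ne_zero _ h'

/-- Exchanging the order in which two distinct points are removed. -/
lemma sum_succAbove_comm {M : Type*} [AddCommMonoid M] {n : ℕ}
    (f : Fin (n + 2) → Fin (n + 1) → M) :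
    ∑ p, ∑ i, f p i =
      ∑ p : Fin (n + 2), ∑ i : Fin (n + 1), f (p.succAbove i) (i.predAbove p) := by
  have hinv : Function.Involutive (fun q : Fin (n + 2) × Fin (n + 1) =>
      (q.1.succAbove q.2, q.2.predAbove q.1)) := by
    rintro ⟨p, i⟩
    refine Prod.ext (Fin.succAbove_succAbove_predAbove p i) ?_
    exact Fin.predAbove_predAbove_succAbove p i
  rw [← Fintype.sum_prod_type', ← Fintype.sum_prod_type' (f :=
    fun (p : Fin (n + 2)) (i : Fin (n + 1)) => f (p.succAbove i) (i.predAbove p))]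
  exact (hinv.bijective.sum_comp fun q => f q.1 q.2).symm

lemma succAbove_castSucc_last {n : ℕ} (q : Fin (n + 1)) :
    q.castSucc.succAbove (Fin.last n) = Fin.last (n + 1) := by
  rw [Fin.succAbove_of_le_castSucc _ _ (Fin.castSucc_le_castSucc_iff.2 (Fin.le_last q)),
    Fin.succ_last]

/-- Expansion of the Pfaffian along the last column. -/
lemma pfRec_last_column : ∀ (N : ℕ), Even N → ∀ A : Fin (N + 2) → Fin (N + 2) → R,
    pfRec (N + 2) A = ∑ i : Fin (N + 1), (-1) ^ (i : ℕ) * A i.castSucc (Fin.last _) *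
      pfRec N (fun r s => A (i.succAbove r).castSucc (i.succAbove s).castSucc)
  | 0, _, A => by simp [pfRec]
  | 1, h, _ => by simp at h
  | N + 2, hN, A => by
    have hN' : Even N := by simpa [Nat.even_add] using hN
    have ih := pfRec_last_column N hN'
    rw [pfRec_add_two, Fin.sum_univ_castSucc, add_comm]
    conv_rhs => rw [Fin.sum_univ_succ]
    congr 1
    -- The pair {0, last} occurs in both expansions; its sign in the row expansion is +1 because `N`
    -- is even.
    · simp [hN]
    · conv_lhs => simp only [ih]
      simp only [pfRec_add_two N, Finset.mul_sum]
      -- Expanding each row minor along its last column, and each column minor along its first row,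
      -- pairs 0 and the last index with the same two points. Only the order of their removal
      -- differs, and `hs` compares the signs.
      rw [sum_succAbove_comm]
      refine Finset.sum_congr rfl fun p _ => Finset.sum_congr rfl fun i _ => ?_
      have hs := Fin.neg_one_pow_succAbove_add_predAbove (R := R) p i
      rw [pow_add, pow_add] at hs
      simp only [Fin.val_castSucc, Fin.val_succ, Fin.succ_castSucc, Fin.succ_succAbove_zero,
        Fin.succ_succAbove_succ, Fin.castSucc_succAbove_castSucc, succAbove_castSucc_last,
        Fin.succ_last, Fin.castSucc_zero, Fin.succAbove_succAbove_predAbove,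
        Fin.succAbove_succAbove_succAbove_predAbove, pow_succ]
      linear_combination (A 0 (p.succAbove i).succ.castSucc *
        A p.succ.castSucc (Fin.last _) * pfRec N (fun r s =>
          A (p.succAbove (i.succAbove r)).succ.castSucc
            (p.succAbove (i.succAbove s)).succ.castSucc)) * hs

end Pfaffian

/-! ### Product identities and Schur's Pfaffian -/

section Products

variable {K : Type*} [Field K]

/-- The product `∏_{i < j} (x_i - x_j) / (x_i + x_j)`. -/
def diffProd {n : ℕ} (x : Fin n → K) : K :=
  ∏ i, ∏ j ∈ Finset.Ioi i, (x i - x j) / (x i + x j)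

/-- The product `∏_{j ≠ i} (x_i + x_j) / (x_i - x_j)`. -/
def crossProd {n : ℕ} (x : Fin (n + 1) → K) (i : Fin (n + 1)) : K :=
  ∏ j, (x i + x (i.succAbove j)) / (x i - x (i.succAbove j))

/-- No denominator `x_i - x_j` or `x_i + x_j` with `i ≠ j` vanishes. -/
def PairwiseRegular {n : ℕ} (x : Fin n → K) : Prop :=
  ∀ i j, i ≠ j → x i - x j ≠ 0 ∧ x i + x j ≠ 0

lemma PairwiseRegular.comp {n m : ℕ} {x : Fin n → K} (hx : PairwiseRegular x)
    {f : Fin m → Fin n} (hf : Function.Injective f) : PairwiseRegular (fun i => x (f i)) :=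
  fun _ _ hij => hx _ _ (hf.ne hij)

lemma PairwiseRegular.injective {n : ℕ} {x : Fin n → K} (hx : PairwiseRegular x) :
    Function.Injective x := by
  intro i j hij
  by_contra h
  exact (hx i j h).1 (sub_eq_zero.2 hij)

lemma PairwiseRegular.snoc_zero {n : ℕ} {x : Fin n → K} (hx : PairwiseRegular x)
    (hx0 : ∀ i, x i ≠ 0) : PairwiseRegular (Fin.snoc (α := fun _ => K) x 0) := by
  intro i j
  refine Fin.lastCases ?_ (fun i => ?_) i <;> refine Fin.lastCases ?_ (fun j => ?_) j
  · simp
  · simp [hx0]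
  · simp [hx0]
  · intro h
    simpa using hx i j (fun h' => h (by rw [h']))

lemma diffProd_ne_zero {n : ℕ} {x : Fin n → K} (hx : PairwiseRegular x) : diffProd x ≠ 0 := by
  refine Finset.prod_ne_zero_iff.2 fun i _ => Finset.prod_ne_zero_iff.2 fun j hj => ?_
  have := hx i j (Finset.mem_Ioi.1 hj).ne
  exact div_ne_zero this.1 this.2

lemma diffProd_succ {n : ℕ} (x : Fin (n + 1) → K) :
    diffProd x = (∏ j : Fin n, (x 0 - x j.succ) / (x 0 + x j.succ)) *
      diffProd (fun j => x j.succ) := by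
  simp only [diffProd, Fin.prod_univ_succ, Fin.prod_Ioi_zero, Fin.prod_Ioi_succ]

lemma diffProd_comp_perm {n : ℕ} (x : Fin n → K) (σ : Equiv.Perm (Fin n)) :
    diffProd (fun i => x (σ i)) = ((Equiv.Perm.sign σ : ℤ) : K) * diffProd x :=
  σ.prod_Ioi_comp_eq_sign_mul_prod (f := fun i j => (x i - x j) / (x i + x j)) fun i j => by
    rw [← neg_div, neg_sub, add_comm]

/-- Moving x_i to the front is a cycle of sign (-1)^i, after which its factors split off. -/
lemma diffProd_eq_succAbove {n : ℕ} (x : Fin (n + 1) → K) (i : Fin (n + 1)) :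
    diffProd x = (-1) ^ (i : ℕ) *
      (∏ j, (x i - x (i.succAbove j)) / (x i + x (i.succAbove j))) *
        diffProd (fun j => x (i.succAbove j)) := by
  have h := diffProd_comp_perm x i.cycleRange.symm
  rw [diffProd_succ] at h
  simp only [Fin.cycleRange_symm_zero, Fin.cycleRange_symm_succ, Equiv.Perm.sign_symm,
    Fin.sign_cycleRange] at h
  rw [mul_assoc, h]
  push_cast
  rw [← mul_assoc, ← mul_pow]
  simp

lemma diffProd_comp_succAbove {n : ℕ} {x : Fin (n + 1) → K} (hx : PairwiseRegular x)
    (i : Fin (n + 1)) :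
    diffProd (fun j => x (i.succAbove j)) = (-1) ^ (i : ℕ) * crossProd x i * diffProd x := by
  have h1 : crossProd x i * ∏ j, (x i - x (i.succAbove j)) / (x i + x (i.succAbove j)) = 1 := by
    rw [crossProd, ← Finset.prod_mul_distrib]
    refine Finset.prod_eq_one fun j _ => ?_
    have := hx i (i.succAbove j) (Fin.succAbove_ne i j).symm
    have h1 := this.1
    have h2 := this.2
    field_simp
  have h2 : ((-1 : K) ^ (i : ℕ)) * (-1) ^ (i : ℕ) = 1 := by rw [← mul_pow]; simp
  rw [diffProd_eq_succAbove x i]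
  linear_combination (-diffProd (fun j => x (i.succAbove j))) *
    (h2 + (-1) ^ (i : ℕ) * (-1) ^ (i : ℕ) * h1)

-- With Q = ∏ (X + x_j), the polynomial (Q(X) - Q(-X))/X takes the value 2 ∏_{j≠p} (x_p + x_j) at
-- x_p, since Q(-x_p) = 0. Its coefficient of X^n vanishes because n + 1 is even; by Lagrange
-- interpolation at the n + 1 points this coefficient is twice the sum.
open Polynomial in
lemma sum_crossProd_eq_zero {n : ℕ} (h2 : (2 : K) ≠ 0) (hn : Even (n + 1)) {x : Fin (n + 1) → K}
    (hx : Function.Injective x) : ∑ i, crossProd x i = 0 := by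
  set Q : K[X] := ∏ j, (X + C (x j)) with hQ
  set S : K[X] := Q - Q.comp (-X) with hS
  have hQdeg : Q.natDegree = n + 1 := by
    rw [hQ, natDegree_prod_of_monic _ _ fun j _ => monic_X_add_C _]
    simp
  have hScoeff : ∀ k, S.coeff k = Q.coeff k - (-1) ^ k * Q.coeff k := by
    intro k
    have : (-X : K[X]) = C (-1) * X := by simp
    rw [hS, coeff_sub, this, comp_C_mul_X_coeff, mul_comm (Q.coeff k) ((-1) ^ k)]
  have hX : X * S.divX = S := by
    have := X_mul_divX_add S
    rwa [hScoeff, pow_zero, one_mul, sub_self, C_0, add_zero] at this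
  have heval : ∀ p, S.divX.eval (x p) = 2 * ∏ j, (x p + x (p.succAbove j)) := by
    intro p
    set T : K[X] := ∏ j, (X + C (x (p.succAbove j))) with hT
    have hQT : Q = (X + C (x p)) * T := by rw [hQ, Fin.prod_univ_succAbove _ p]
    have hTe : T.eval (x p) = ∏ j, (x p + x (p.succAbove j)) := by
      rw [hT, eval_prod]; simp
    rw [← hTe]
    -- At x_p = 0 the factor x_p cannot be cancelled after evaluation, so X is cancelled in the
    -- polynomial ring.
    by_cases h0 : x p = 0
    · have : X * S.divX = X * (T + T.comp (-X)) := by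
        rw [hX, hS, hQT, h0]
        simp
        ring
      rw [mul_left_cancel₀ X_ne_zero this, h0]
      simp
      ring
    · have := congrArg (eval (x p)) hX
      rw [hS, hQT] at this
      simp only [eval_mul, eval_X, eval_sub, eval_add, eval_C, eval_comp, eval_neg,
        neg_add_cancel, zero_mul, sub_zero] at this
      rw [← hQT, ← hS] at this
      refine mul_left_cancel₀ h0 ?_
      rw [this]
      ring
  have hdeg : S.divX.degree < #(univ : Finset (Fin (n + 1))) := by
    rw [Finset.card_fin, degree_lt_iff_coeff_zero]
    intro m hm
    rw [coeff_divX, hScoeff, coeff_eq_zero_of_natDegree_lt (by omega)]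
    simp
  have hL := Lagrange.coeff_eq_sum (s := univ) (v := x) hx.injOn hdeg
  rw [Finset.card_fin, Nat.add_sub_cancel, coeff_divX, hScoeff, hn.neg_one_pow, one_mul,
    sub_self] at hL
  have hsum : ∑ i, crossProd x i * 2 = 0 := by
    rw [hL]
    refine Finset.sum_congr rfl fun i _ => ?_
    have : (univ : Finset (Fin (n + 1))).erase i = univ.image i.succAbove := by
      ext j
      simp
    rw [heval, this, Finset.prod_image fun _ _ _ _ h => Fin.succAbove_right_injective h, crossProd,
      Finset.prod_div_distrib]
    ring
  rw [← Finset.sum_mul] at hsum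
  exact (mul_eq_zero.1 hsum).resolve_right h2

/-- This is the vanishing of the sum of cross products at the points -x_0, x_1, …, x_{n+1}; they are
distinct because x_0 + x_j ≠ 0. -/
lemma sum_mul_crossProd {n : ℕ} (h2 : (2 : K) ≠ 0) (hn : Even n) {x : Fin (n + 2) → K}
    (hx : PairwiseRegular x) :
    ∑ p : Fin (n + 1), (x 0 - x p.succ) / (x 0 + x p.succ) * crossProd (fun j => x j.succ) p =
      ∏ j : Fin (n + 1), (x 0 - x j.succ) / (x 0 + x j.succ) := by
  set z : Fin (n + 2) → K := Fin.cons (-x 0) fun j => x j.succ with hz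
  have hinj : Function.Injective z := by
    refine Fin.cons_injective_iff.2 ⟨?_, hx.injective.comp (Fin.succ_injective _)⟩
    rintro ⟨j, hj⟩
    exact (hx 0 j.succ (Fin.succ_ne_zero j).symm).2 (by linear_combination hj)
  have h := sum_crossProd_eq_zero h2 (by simpa [Nat.even_add] using hn) hinj
  rw [Fin.sum_univ_succ] at h
  have e0 : crossProd z 0 = ∏ j : Fin (n + 1), (x 0 - x j.succ) / (x 0 + x j.succ) := by
    refine Finset.prod_congr rfl fun j _ => ?_
    simp only [Fin.zero_succAbove, hz, Fin.cons_zero, Fin.cons_succ]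
    rw [← neg_div_neg_eq]
    congr 1 <;> ring
  have e1 : ∀ p : Fin (n + 1), crossProd z p.succ =
      -((x 0 - x p.succ) / (x 0 + x p.succ) * crossProd (fun j => x j.succ) p) := by
    intro p
    rw [crossProd, Fin.prod_univ_succ, crossProd, ← neg_mul]
    simp only [Fin.succ_succAbove_zero, Fin.succ_succAbove_succ, hz, Fin.cons_zero, Fin.cons_succ]
    congr 1
    rw [← neg_div]
    congr 1 <;> ring
  rw [e0, Finset.sum_congr rfl fun p _ => e1 p, Finset.sum_neg_distrib, add_neg_eq_zero] at h
  exact h.symm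

/-- Schur's evaluation of the Pfaffian of `((x_i - x_j) / (x_i + x_j))`. -/
lemma pfRec_diff_div_add (h2 : (2 : K) ≠ 0) : ∀ (n : ℕ), Even n → ∀ x : Fin n → K,
    PairwiseRegular x → pfRec n (fun i j => (x i - x j) / (x i + x j)) = diffProd x
  | 0, _, x, _ => by simp [pfRec, diffProd]
  | 1, h, _, _ => by simp at h
  | n + 2, hn, x, hx => by
    have hn' : Even n := by simpa [Nat.even_add] using hn
    rw [pfRec_add_two, diffProd_succ, ← sum_mul_crossProd h2 hn' hx, Finset.sum_mul]
    refine Finset.sum_congr rfl fun p _ => ?_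
    have hy := hx.comp (Fin.succ_injective _)
    rw [pfRec_diff_div_add h2 n hn' (fun i => x (p.succAbove i).succ)
      (hy.comp Fin.succAbove_right_injective), diffProd_comp_succAbove hy p]
    have h2 : ((-1 : K) ^ (p : ℕ)) * (-1) ^ (p : ℕ) = 1 := by rw [← mul_pow]; simp
    linear_combination ((x 0 - x p.succ) / (x 0 + x p.succ) *
      crossProd (fun j => x j.succ) p * diffProd (fun j => x j.succ)) * h2

end Products

/-! ### The common recursion for the Pfaffian and the P-function -/

section Recursion

variable {K : Type*} [Field K]

/-- The symmetrization `∑ ∏_{i ≤ l} F_i(x_{p_i}) ∏ (x_{p_i} + x_q) / (x_{p_i} - x_q)` over sequences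
of distinct indices `p_1, …, p_l`, the inner product being over `q ∉ {p_1, …, p_i}`; defined by
recursion on `l`. -/
def crossSum : (l n : ℕ) → (ℕ → K → K) → (Fin n → K) → K
  | 0, _, _, _ => 1
  | _ + 1, 0, _, _ => 0
  | l + 1, n + 1, F, x => ∑ p, F 0 (x p) * crossProd x p *
      crossSum l n (fun k => F (k + 1)) (fun j => x (p.succAbove j))

lemma crossSum_succ (l n : ℕ) (F : ℕ → K → K) (x : Fin (n + 1) → K) :
    crossSum (l + 1) (n + 1) F x = ∑ p, F 0 (x p) * crossProd x p *
      crossSum l n (fun k => F (k + 1)) (fun j => x (p.succAbove j)) := rfl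

lemma snoc_zero_comp_succAbove {n : ℕ} (x : Fin (n + 1) → K) (p : Fin (n + 1)) :
    (fun j => (Fin.snoc x 0 : Fin (n + 2) → K) (p.castSucc.succAbove j)) =
      (Fin.snoc (fun j => x (p.succAbove j)) 0 : Fin (n + 1) → K) := by
  funext j
  refine Fin.lastCases ?_ (fun j => ?_) j
  · rw [succAbove_castSucc_last, Fin.snoc_last, Fin.snoc_last]
  · rw [Fin.castSucc_succAbove_castSucc, Fin.snoc_castSucc, Fin.snoc_castSucc]

lemma crossProd_snoc_zero {n : ℕ} {x : Fin (n + 1) → K} (hx0 : ∀ i, x i ≠ 0) (p : Fin (n + 1)) :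
    crossProd (Fin.snoc x 0 : Fin (n + 2) → K) p.castSucc = crossProd x p := by
  rw [crossProd, Fin.prod_univ_castSucc, crossProd]
  simp [Fin.castSucc_succAbove_castSucc, hx0]

/-- Appending a zero variable does not change `crossSum`. -/
lemma crossSum_snoc_zero : ∀ (l n : ℕ) (F : ℕ → K → K) (x : Fin n → K),
    (∀ k < l, F k 0 = 0) → (∀ i, x i ≠ 0) →
      crossSum l (n + 1) F (Fin.snoc (α := fun _ => K) x 0) = crossSum l n F x
  | 0, _, _, _, _, _ => by simp [crossSum]
  | l + 1, 0, F, x, hF, _ => by simp [crossSum, Fin.snoc, hF]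
  | l + 1, n + 1, F, x, hF, hx0 => by
    rw [crossSum_succ, crossSum_succ, Fin.sum_univ_castSucc]
    -- Choosing the zero variable first contributes F_0(0) = 0. In the other terms it only adds a
    -- factor (x_p + 0)/(x_p - 0) = 1.
    simp only [Fin.snoc_last, hF 0 (Nat.succ_pos l), zero_mul, add_zero, Fin.snoc_castSucc]
    refine Finset.sum_congr rfl fun p _ => ?_
    rw [crossProd_snoc_zero hx0, snoc_zero_comp_succAbove, crossSum_snoc_zero l n _ _
      (fun k hk => hF (k + 1) (Nat.succ_lt_succ hk)) fun i => hx0 _]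

lemma diffProd_snoc_zero {n : ℕ} {x : Fin n → K} (hx0 : ∀ i, x i ≠ 0) :
    diffProd (Fin.snoc (α := fun _ => K) x 0) = diffProd x := by
  simp only [diffProd, ← Finset.filter_lt_eq_Ioi, Finset.prod_filter, Fin.prod_univ_castSucc,
    Fin.snoc_castSucc, Fin.snoc_last, sub_zero, add_zero, div_self (hx0 _), ite_self, mul_one,
    Fin.castSucc_lt_castSucc_iff, (Fin.castSucc_lt_last _).not_gt, lt_self_iff_false, if_false,
    Finset.prod_const_one]

lemma sum_fin_eq_sum_of_eq_zero {M : Type*} [AddCommMonoid M] {a b : ℕ} (hab : a ≤ b)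
    (g : Fin b → M) (hg : ∀ i : Fin b, a ≤ i → g i = 0) :
    ∑ i, g i = ∑ i : Fin a, g (i.castLE hab) := by
  obtain ⟨c, rfl⟩ := Nat.exists_eq_add_of_le hab
  rw [Fin.sum_univ_add, Finset.sum_eq_zero (s := univ (α := Fin c)) fun i _ => hg _ (by simp),
    add_zero]
  rfl

/-- The Pfaffian of a block matrix `[[A₀, B], [*, 0]]` with `A₀ = ((x_i - x_j) / (x_i + x_j))` and
`B` the matrix of values of the functions `F_{l-1}, …, F_0`. -/
lemma pfRec_block (h2 : (2 : K) ≠ 0) : ∀ (l n N : ℕ), N = n + l → Even N →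
    ∀ (F : ℕ → K → K) (x : Fin n → K), PairwiseRegular x → ∀ A : Fin N → Fin N → K,
    (∀ (i j : Fin N) (hi : i.val < n) (hj : j.val < n),
      A i j = (x ⟨i, hi⟩ - x ⟨j, hj⟩) / (x ⟨i, hi⟩ + x ⟨j, hj⟩)) →
    (∀ (i j : Fin N) (hi : i.val < n), n ≤ j.val → A i j = F (N - 1 - j) (x ⟨i, hi⟩)) →
    (∀ i j : Fin N, n ≤ i.val → n ≤ j.val → A i j = 0) →
    pfRec N A = crossSum l n F x * diffProd x
  | 0, n, N, h, hN, F, x, hx, A, h1, _, _ => by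
    obtain rfl : N = n := h
    rw [crossSum, one_mul, ← pfRec_diff_div_add h2 N hN x hx]
    congr 1
    funext i j
    exact h1 i j i.2 j.2
  | l + 1, 0, N, h, hN, F, x, hx, A, h1, _, h3 => by
    obtain ⟨M, rfl⟩ : ∃ M, N = M + 2 := ⟨N - 2, by have := hN.two_dvd; omega⟩
    rw [pfRec_last_column M (by simpa [Nat.even_add] using hN), crossSum, zero_mul]
    refine Finset.sum_eq_zero fun i _ => ?_
    rw [h3 _ _ (Nat.zero_le _) (Nat.zero_le _), mul_zero, zero_mul]
  | l + 1, n + 1, N, h, hN, F, x, hx, A, h1, hB, h3 => by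
    obtain ⟨M, rfl⟩ : ∃ M, N = M + 2 := ⟨N - 2, by omega⟩
    have hM : Even M := by simpa [Nat.even_add] using hN
    have hMn : M = n + l := by omega
    -- Only the first n + 1 rows meet the last column outside the zero block. Deleting row p and the
    -- last index leaves a block matrix of the same kind, with x_p removed and `F` shifted by one.
    rw [pfRec_last_column M hM, crossSum_succ, Finset.sum_mul,
      sum_fin_eq_sum_of_eq_zero (a := n + 1) (by omega)]
    · refine Finset.sum_congr rfl fun p _ => ?_
      set q : Fin (M + 1) := p.castLE (by omega) with hq
      have hlt : ∀ (i : Fin M) (hi : i.val < n),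
          ((q.succAbove i).castSucc : ℕ) = p.succAbove ⟨i, hi⟩ := by
        intro i hi
        simp only [Fin.val_castSucc, Fin.succAbove, Fin.lt_def, hq, Fin.val_castLE]
        split_ifs <;> simp
      have hge : ∀ i : Fin M, n ≤ i.val → ((q.succAbove i).castSucc : ℕ) = i + 1 := by
        intro i hi
        have := p.2
        simp only [Fin.val_castSucc, Fin.succAbove, Fin.lt_def, hq, Fin.val_castLE]
        rw [if_neg (by omega), Fin.val_succ]
      have hx' : ∀ (i : Fin M) (hi : i.val < n) (h' : _),
          x ⟨((q.succAbove i).castSucc : ℕ), h'⟩ = x (p.succAbove ⟨i, hi⟩) :=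
        fun i hi _ => congrArg x (Fin.ext (hlt i hi))
      have hb : ∀ (i : Fin M) (hi : i.val < n), ((q.succAbove i).castSucc : ℕ) < n + 1 :=
        fun i hi => by rw [hlt i hi]; exact Fin.is_lt _
      rw [pfRec_block h2 l n M hMn hM (fun k => F (k + 1)) (fun j => x (p.succAbove j))
        (hx.comp Fin.succAbove_right_injective)]
      · have hA : A q.castSucc (Fin.last _) = F 0 (x p) := by
          rw [hB _ _ p.2 (by rw [Fin.val_last]; omega), Fin.val_last]
          congr 1
          simp
        rw [hA, diffProd_comp_succAbove hx p]
        have hs : ((-1 : K) ^ (p : ℕ)) * (-1) ^ (p : ℕ) = 1 := by rw [← mul_pow]; simp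
        have hqp : (q : ℕ) = p := rfl
        rw [hqp]
        -- The cofactor sign cancels the sign from deleting x_p in `diffProd`.
        linear_combination (F 0 (x p) * crossProd x p * diffProd x *
          crossSum l n (fun k => F (k + 1)) fun j => x (p.succAbove j)) * hs
      · intro i j hi hj
        rw [h1 _ _ (hb i hi) (hb j hj), hx' i hi, hx' j hj]
      · intro i j hi hj
        rw [hB _ _ (hb i hi) (by rw [hge j hj]; omega), hx' i hi, hge j hj]
        congr 1
        have := j.2
        omega
      · intro i j hi hj
        exact h3 _ _ (by rw [hge i hi]; omega) (by rw [hge j hj]; omega)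
    · intro i hi
      rw [h3 _ _ hi (by rw [Fin.val_last]; omega), mul_zero, zero_mul]

/-- The sum over permutations in the definition of a Schur `P`-function is, up to a factorial,
`crossSum`. -/
lemma sum_perm_eq_crossSum : ∀ (l n : ℕ), l ≤ n → ∀ (F : ℕ → K → K) (x : Fin n → K),
    ∑ ω : Equiv.Perm (Fin n),
        (∏ i : Fin n with i.val < l, F i (x (ω i))) *
        ∏ i : Fin n with i.val < l, ∏ j : Fin n with i < j,
          (x (ω i) + x (ω j)) / (x (ω i) - x (ω j)) =
      ((n - l).factorial : K) * crossSum l n F x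
  | 0, n, _, F, x => by simp [crossSum, Fintype.card_perm]
  | l + 1, 0, h, _, _ => by omega
  | l + 1, n + 1, h, F, x => by
    rw [sum_perm_fin_succ, crossSum_succ, Finset.mul_sum, Nat.add_sub_add_right]
    refine Finset.sum_congr rfl fun p _ => ?_
    have ih := sum_perm_eq_crossSum l n (Nat.le_of_succ_le_succ h) (fun k => F (k + 1))
      (fun j => x (p.succAbove j))
    rw [mul_left_comm, ← ih, Finset.mul_sum]
    refine Finset.sum_congr rfl fun σ _ => ?_
    -- The factors of the first position run over all other points, so their product does not depend
    -- on σ.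
    have hc : crossProd x p =
        ∏ j, (x p + x (p.succAbove (σ j))) / (x p - x (p.succAbove (σ j))) :=
      (Equiv.prod_comp σ fun j => (x p + x (p.succAbove j)) / (x p - x (p.succAbove j))).symm
    simp only [Finset.prod_filter, Fin.prod_univ_succ, consPerm_zero, consPerm_succ, Fin.val_zero,
      Fin.val_succ, Nat.succ_pos, Nat.succ_lt_succ_iff, if_true, Fin.succ_lt_succ_iff,
      Fin.succ_pos, Fin.not_lt_zero, if_false, one_mul, hc]
    ring

end Recursion

/-! ### Specialization to P-functions and rational functions -/

section Main

variable {K : Type*} [Field K]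

lemma partAt_pos {m : ℕ} (lam : m.Partition) {i : ℕ} (hi : i < partLength lam) :
    0 < partAt lam i := by
  have hi' : i < (lam.parts.sort (fun p q => q ≤ p)).length := by
    rwa [Multiset.length_sort]
  rw [partAt, List.getD_eq_getElem _ _ hi']
  exact lam.parts_pos ((Multiset.mem_sort _).1 (List.getElem_mem hi'))

lemma genPow_zero_left {a : ℕ → K} (ha : a 1 = 0) {k : ℕ} (hk : 0 < k) :
    genPow (0 : K) a k = 0 :=
  Finset.prod_eq_zero (Finset.mem_Icc.2 ⟨le_rfl, hk⟩) (by rw [ha, sub_zero])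

lemma pfaffian_matA0 (h2 : (2 : K) ≠ 0) {n : ℕ} (hn : Even n) {x : Fin n → K}
    (hx : PairwiseRegular x) : pfaffian (matA0 x) = diffProd x := by
  obtain ⟨k, rfl⟩ := hn.two_dvd
  rw [pfaffian_eq_pfRec, ← pfRec_diff_div_add h2 _ hn x hx]
  rfl

lemma pfaffian_matA (h2 : (2 : K) ≠ 0) {m : ℕ} (lam : m.Partition) (a : ℕ → K) {n : ℕ}
    (hn : Even (n + partLength lam)) {x : Fin n → K} (hx : PairwiseRegular x) :
    pfaffian (matA lam a x) =
      crossSum (partLength lam) n (fun k y => genPow y a (partAt lam k)) x * diffProd x := by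
  have key : pfRec (n + partLength lam) (matA lam a x) =
      crossSum (partLength lam) n (fun k y => genPow y a (partAt lam k)) x * diffProd x := by
    refine pfRec_block h2 _ _ _ rfl hn _ x hx _ ?_ ?_ ?_
    all_goals
      intro i j
      refine Fin.addCases (fun i => ?_) (fun i => ?_) i <;>
        refine Fin.addCases (fun j => ?_) (fun j => ?_) j
    all_goals
      simp [matA, matA0, matB]
    -- The reversed column order in `matB` matches the index N - 1 - j of `pfRec_block`.
    congr 2
    omega
  have hpf : ∀ (N : ℕ), Even N → ∀ A : Matrix (Fin N) (Fin N) K, pfaffian A = pfRec N A := by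
    intro N hN A
    obtain ⟨k, rfl⟩ := hN.two_dvd
    exact pfaffian_eq_pfRec k A
  rw [hpf _ hn, key]

lemma pfZero_eq_diffProd (h2 : (2 : K) ≠ 0) {n : ℕ} {x : Fin n → K} (hx : PairwiseRegular x)
    (hx0 : ∀ i, x i ≠ 0) : pfZero x = diffProd x := by
  rw [pfZero]
  split_ifs with h
  · exact pfaffian_matA0 h2 h hx
  · rw [pfaffian_matA0 h2 (Nat.not_even_iff_odd.1 h).add_one (hx.snoc_zero hx0),
      diffProd_snoc_zero hx0]

lemma pfLambda_eq_crossSum_mul_diffProd (h2 : (2 : K) ≠ 0) {m : ℕ} (lam : m.Partition)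
    {a : ℕ → K} (ha : a 1 = 0) {n : ℕ} {x : Fin n → K} (hx : PairwiseRegular x)
    (hx0 : ∀ i, x i ≠ 0) :
    pfLambda lam a x =
      crossSum (partLength lam) n (fun k y => genPow y a (partAt lam k)) x * diffProd x := by
  rw [pfLambda]
  split_ifs with h
  · exact pfaffian_matA h2 lam a h hx
  · have h' : Even (n + 1 + partLength lam) := by
      rw [Nat.add_right_comm]
      exact (Nat.not_even_iff_odd.1 h).add_one
    rw [pfaffian_matA h2 lam a h' (hx.snoc_zero hx0), diffProd_snoc_zero hx0,
      crossSum_snoc_zero _ _ _ _ (fun k hk => genPow_zero_left ha (partAt_pos lam hk)) hx0]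

lemma schurP_eq_crossSum [CharZero K] {m : ℕ} (lam : m.Partition) (a : ℕ → K) {n : ℕ}
    (hn : partLength lam ≤ n) (x : Fin n → K) :
    schurP lam a x =
      crossSum (partLength lam) n (fun k y => genPow y a (partAt lam k)) x := by
  rw [schurP, if_pos hn,
    sum_perm_eq_crossSum _ _ hn (fun k y => genPow y a (partAt lam k)) x, ← mul_assoc,
    inv_mul_cancel₀ (Nat.cast_ne_zero.2 (Nat.factorial_ne_zero _)), one_mul]

lemma ratVar_ne_zero {n : ℕ} (i : Fin n) : ratVar n i ≠ 0 := by
  rw [ratVar, Ne, IsFractionRing.to_map_eq_zero_iff]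
  exact MvPolynomial.X_ne_zero i

lemma pairwiseRegular_ratVar (n : ℕ) : PairwiseRegular (ratVar n) := by
  intro i j hij
  constructor
  · rw [sub_ne_zero]
    intro h
    exact hij (MvPolynomial.X_injective (IsFractionRing.injective _ _ h))
  · rw [ratVar, ratVar, ← map_add, Ne, IsFractionRing.to_map_eq_zero_iff]
    intro h
    -- At the point with all coordinates 1 the sum X_i + X_j takes the value 2.
    have := congrArg (MvPolynomial.eval fun _ => (1 : ℂ)) h
    norm_num at this

instance charZero_ratFun (n : ℕ) : CharZero (RatFun n) :=
  charZero_of_injective_algebraMap (IsFractionRing.injective (MvPolynomial (Fin n) ℂ) (RatFun n))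

end Main

theorem mainTheorem1 (m : ℕ) (lam : m.Partition) (hlam : lam ∈ Nat.Partition.distincts m)
    (n : ℕ) (hn : partLength lam ≤ n) (a : ℕ → ℂ) (ha : a 1 = 0) :
    pfZero (ratVar n) ≠ 0 ∧
      schurP lam (fun k => ratConst n (a k)) (ratVar n) =
        pfLambda lam (fun k => ratConst n (a k)) (ratVar n) / pfZero (ratVar n) := by
  have h2 : (2 : RatFun n) ≠ 0 := two_ne_zero
  have hx := pairwiseRegular_ratVar n
  have hx0 : ∀ i, ratVar n i ≠ 0 := ratVar_ne_zero
  have ha' : ratConst n (a 1) = 0 := by simp [ratConst, ha]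
  have hD := diffProd_ne_zero hx
  rw [pfZero_eq_diffProd h2 hx hx0]
  refine ⟨hD, ?_⟩
  rw [pfLambda_eq_crossSum_mul_diffProd h2 lam ha' hx hx0, schurP_eq_crossSum lam _ hn,
    mul_div_cancel_right₀ _ hD]
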